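/- The game of War is played by Alice and Bob with a deck of $n$ distinct cards labelled $1,\dots,n$. In each round both players reveal the top card of their hands, and the player with the higher card puts both cards at the bottom of their own hand; the game ends when a player has no cards left, and that player loses. With WL-putback the winning card of the round is always put back first and the losing card second; with random putback the two cards are put back in either order with probability $\tfrac12$ each, independently in each round. In an $m$-card initial state Alice holds $m$ cards (and Bob $n-m$), and a uniformly random such state is obtained by dealing a uniformly random ordering $a_1\dots a_m\,|\,a_{m+1}\dots a_n$ of the deck. A game is single-use if Bob wins within his first $n-m$ rounds (his first passthrough). Let $C(p,q)$ denote the entry of the Catalan triangle: the number of strings of $p$ letters $U$ and $q$ letters $D$ in which every initial substring has at least as many $U$'s as $D$'s. **Theorem.** Let $m\ge 1$, $R\ge 0$ and $n\ge m+R$. For a uniformly random $m$-card initial state played with WL-putback, the probability that the game is single-use and lasts exactly $R$ rounds is $$\frac{1}{2^R}\,C\!\left(\frac{R+m}{2}-1,\ \frac{R-m}{2}\right)$$ if $R\ge m$ and $R\equiv m \pmod 2$, and it is $0$ otherwise. The corresponding probability under random putback has the same value. -/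

import Mathlib

open scoped ENNReal

noncomputable section

/-- A configuration of the game of War with cards from `α`: the hands of Alice and Bob, listed from
top to bottom, and the number of rounds that have been played so far. -/
structure WarConfig (α : Type) where
  alice : List α
  bob : List α
  rounds : ℕ

/-- A putback rule: `pb w l` is the law of the order in which the winning card `w` and the losing
card `l` of a round are put back to the bottom of the winner's hand (first entry put back first). -/
abbrev Putback (α : Type) : Type := α → α → PMF (List α)

/-- WL-putback: the winning card is put back first, the losing card second. -/
def wlPutback {α : Type} : Putback α := fun w l => PMF.pure [w, l]

/-- Random putback: the two cards are put back in either order, decided by a fair coin. -/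
def randomPutback {α : Type} : Putback α := fun w l =>
  (PMF.uniformOfFintype Bool).map fun c => if c then [w, l] else [l, w]

/-- One round: both players reveal their top cards and the player with the higher card puts both
cards to the bottom of their own hand. If one hand is empty, the game is over and nothing changes
(in particular the number of rounds is not increased). -/
def playRound {α : Type} [LinearOrder α] (pb : Putback α) : WarConfig α → PMF (WarConfig α)
  | ⟨a :: as, b :: bs, r⟩ =>
      if b < a then (pb a b).map fun l => ⟨as ++ l, bs, r + 1⟩
      else (pb b a).map fun l => ⟨as, bs ++ l, r + 1⟩
  | c => PMF.pure c

/-- The law of the configuration reached from `c` when (up to) `N` further rounds are played, the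
game stopping as soon as a hand is empty. -/
def playRounds {α : Type} [LinearOrder α] (pb : Putback α) : ℕ → WarConfig α → PMF (WarConfig α)
  | 0, c => PMF.pure c
  | N + 1, c => (playRound pb c).bind (playRounds pb N)

/-- The `m`-card state `a₁ … a_m | a_{m+1} … a_n` given by an ordering `σ` of the deck of `n`
distinct cards `Fin n` (only the order of the card values matters). -/
def initialConfig {n : ℕ} (m : ℕ) (σ : Equiv.Perm (Fin n)) : WarConfig (Fin n) where
  alice := (List.ofFn σ).take m
  bob := (List.ofFn σ).drop m
  rounds := 0

/-- The law of the configuration after (up to) `N` rounds, for a uniformly random `m`-card initial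
state on `n` cards. -/
def warLaw (n m N : ℕ) (pb : Putback (Fin n)) : PMF (WarConfig (Fin n)) :=
  (PMF.uniformOfFintype (Equiv.Perm (Fin n))).bind fun σ => playRounds pb N (initialConfig m σ)

/-- The event that Bob has won (Alice has lost all her cards), within his first passthrough
(that is, within his first `n - m` rounds), after exactly `R` rounds. -/
def singleUseRRound (n m R : ℕ) : Set (WarConfig (Fin n)) :=
  {c | c.alice = [] ∧ c.rounds ≤ n - m ∧ c.rounds = R}

/-- The probability that the game from a uniformly random `m`-card initial state on `n` cards is a
single-use game that lasts exactly `R` rounds. Whether this happens is decided by the configuration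
after (up to) `R` rounds: its round counter equals `R` only if the game was not over earlier. -/
def rRoundProb (n m R : ℕ) (pb : Putback (Fin n)) : ℝ≥0∞ :=
  (warLaw n m R pb).toOuterMeasure (singleUseRRound n m R)

/-- The entry `C(p, q)` of the Catalan triangle: the number of strings of `p` letters `U` and `q`
letters `D` all of whose initial substrings have at least as many `U`s as `D`s. -/
def catalanTriangle (p q : ℕ) : ℕ :=
  Set.ncard {s : List DyckStep | s.count DyckStep.U = p ∧ s.count DyckStep.D = q ∧
    ∀ i : ℕ, (s.take i).count DyckStep.D ≤ (s.take i).count DyckStep.U}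

end

/-! While Bob is in his first passthrough he plays only unseen cards, so the game is Alice's hand
against a fixed stream. Instead of conditioning on past comparisons, weights `w` on deals are
carried along; `SwapInvariant` records which positions are still exchangeable. The order of Alice's
hand does not matter (`lossSum_wlPutback_perm`): playing her top two cards in the other order
amounts to exchanging the two fresh cards they meet. Hence both putback rules agree
(`lossSum_randomPutback`). Exchanging Alice's top card with the fresh card it meets shows that each
round is a fair coin: after a win both cards stay in her hand and their order is irrelevant, so the
outcome is forgotten; after a loss both leave the game. Her hand size is thus a simple random walk
(`two_pow_mul_lossSum_wlPutback`), and its first passages to `0` are counted by the Catalan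
triangle. -/

open Equiv in
/-- The weight `w` does not change when two positions from `U` are exchanged. -/
def SwapInvariant {n : ℕ} (U : Set (Fin n)) (w : Perm (Fin n) → ℝ≥0∞) : Prop :=
  ∀ i ∈ U, ∀ j ∈ U, ∀ σ, w (σ * swap i j) = w σ

/-! ### Reduction to Alice's hand against a fixed stream of cards. -/

/-- The probability that the hand `A` loses its last card in exactly `R` rounds against the
successive cards of `B`. -/
noncomputable def lossProb {α : Type} [LinearOrder α] (pb : Putback α) : ℕ → List α → List α → ℝ≥0∞
  | 0, [], _ => 1
  | 0, _ :: _, _ => 0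
  | R + 1, a :: A, b :: B =>
      if b < a then ∑' l, pb a b l * lossProb pb R (A ++ l) B else lossProb pb R A B
  | _ + 1, _, _ => 0

theorem playRounds_of_playRound_eq_pure {α : Type} [LinearOrder α] (pb : Putback α)
    {c : WarConfig α} (hc : playRound pb c = PMF.pure c) (R : ℕ) :
    playRounds pb R c = PMF.pure c := by
  induction R with
  | zero => rfl
  | succ R ih => rw [playRounds, hc, PMF.pure_bind, ih]

/-- Cards won by Bob go behind `B`, which lasts for `R` rounds; they never come up, so their putback
order sums out. -/
theorem toOuterMeasure_playRounds {α : Type} [LinearOrder α] (pb : Putback α) (R : ℕ)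
    (A B B' : List α) (r : ℕ) (hB : R ≤ B.length) :
    (playRounds pb R ⟨A, B ++ B', r⟩).toOuterMeasure {c | c.alice = [] ∧ c.rounds = r + R} =
      lossProb pb R A B := by
  induction R generalizing A B B' r with
  | zero => cases A <;> simp [playRounds, lossProb, PMF.toOuterMeasure_pure_apply]
  | succ R ih =>
    cases A with
    | nil =>
      rw [playRounds_of_playRound_eq_pure pb (by simp [playRound])]
      simp [lossProb, PMF.toOuterMeasure_pure_apply]
    | cons a A =>
      cases B with
      | nil => simp at hB
      | cons b B =>
        have hB' : R ≤ B.length := by simpa using hB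
        have hr : r + (R + 1) = r + 1 + R := by omega
        rw [playRounds, List.cons_append, playRound, lossProb, hr]
        split_ifs with h
        · rw [PMF.bind_map, PMF.toOuterMeasure_bind_apply]
          exact tsum_congr fun l => by rw [Function.comp_apply, ih _ _ _ _ hB']
        · rw [PMF.bind_map, PMF.toOuterMeasure_bind_apply]
          have : ∀ l, (playRounds pb R ⟨A, B ++ B' ++ l, r + 1⟩).toOuterMeasure
              {c | c.alice = [] ∧ c.rounds = r + 1 + R} = lossProb pb R A B := fun l => by
            rw [List.append_assoc]; exact ih _ _ _ _ hB'
          simp only [Function.comp_apply, this, ENNReal.tsum_mul_right, PMF.tsum_coe, one_mul]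

theorem lossProb_wlPutback_succ_cons {α : Type} [LinearOrder α] (R : ℕ) (a b : α) (A B : List α) :
    lossProb wlPutback (R + 1) (a :: A) (b :: B) =
      if b < a then lossProb wlPutback R (A ++ [a, b]) B else lossProb wlPutback R A B := by
  rw [lossProb]
  congr 1
  rw [tsum_eq_single [a, b]]
  · simp [wlPutback]
  · intro l hl
    simp [wlPutback, PMF.pure_apply, hl]

theorem tsum_randomPutback_mul {α : Type} (a b : α) (f : List α → ℝ≥0∞) :
    ∑' l, randomPutback a b l * f l = 2⁻¹ * f [a, b] + 2⁻¹ * f [b, a] := by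
  simp only [randomPutback, PMF.map, PMF.bind_apply, ← ENNReal.tsum_mul_right]
  rw [ENNReal.tsum_comm]
  have hc : ∀ c : Bool, ∑' l, PMF.uniformOfFintype Bool c *
      ((PMF.pure ∘ fun c => if c = true then [a, b] else [b, a]) c) l * f l =
      2⁻¹ * f (if c = true then [a, b] else [b, a]) := fun c => by
    rw [tsum_eq_single (if c = true then [a, b] else [b, a])]
    · simp
    · intro l hl
      simp only [Function.comp_apply, PMF.pure_apply, if_neg hl, mul_zero, zero_mul]
  simp only [hc, tsum_fintype, Fintype.sum_bool]
  simp

theorem lossProb_randomPutback_succ_cons {α : Type} [LinearOrder α] (R : ℕ) (a b : α)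
    (A B : List α) :
    lossProb randomPutback (R + 1) (a :: A) (b :: B) =
      if b < a then 2⁻¹ * lossProb randomPutback R (A ++ [a, b]) B +
        2⁻¹ * lossProb randomPutback R (A ++ [b, a]) B
      else lossProb randomPutback R A B := by
  rw [lossProb, tsum_randomPutback_mul]

/-! ### Weighted sums over deals and irrelevance of the order of Alice's hand. -/

section Average

open Equiv

variable {n : ℕ}

/-- The part of the weight `w` on orderings in which the card at position `a` beats the one at
position `b`. -/
def winWeight (a b : Fin n) (w : Perm (Fin n) → ℝ≥0∞) (σ : Perm (Fin n)) : ℝ≥0∞ :=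
  if σ b < σ a then w σ else 0

/-- The part of the weight `w` on orderings in which the card at position `a` does not beat the one
at position `b`. -/
def loseWeight (a b : Fin n) (w : Perm (Fin n) → ℝ≥0∞) (σ : Perm (Fin n)) : ℝ≥0∞ :=
  if σ b < σ a then 0 else w σ

/-- The `w`-weighted sum over all orderings of the probability that Alice, holding the cards at the
positions `A`, loses in exactly `R` rounds against the cards from position `k` on. -/
noncomputable def lossSum (pb : Putback (Fin n)) (w : Perm (Fin n) → ℝ≥0∞) (R : ℕ) (A : List (Fin n)) (k : ℕ) :
    ℝ≥0∞ :=
  ∑ σ : Perm (Fin n), w σ * lossProb pb R (A.map σ) (((List.finRange n).drop k).map σ)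

theorem SwapInvariant.mono {U V : Set (Fin n)} {w : Perm (Fin n) → ℝ≥0∞}
    (h : SwapInvariant V w) (hUV : U ⊆ V) : SwapInvariant U w :=
  fun i hi j hj => h i (hUV hi) j (hUV hj)

theorem SwapInvariant.winWeight {U : Set (Fin n)} {w : Perm (Fin n) → ℝ≥0∞}
    (h : SwapInvariant U w) {a b : Fin n} (ha : a ∉ U) (hb : b ∉ U) :
    SwapInvariant U (winWeight a b w) := by
  intro i hi j hj σ
  have ne {x y : Fin n} (hx : x ∉ U) (hy : y ∈ U) : x ≠ y := fun e => hx (e ▸ hy)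
  simp only [_root_.winWeight, Perm.mul_apply, h i hi j hj,
    swap_apply_of_ne_of_ne (ne ha hi) (ne ha hj), swap_apply_of_ne_of_ne (ne hb hi) (ne hb hj)]

theorem SwapInvariant.loseWeight {U : Set (Fin n)} {w : Perm (Fin n) → ℝ≥0∞}
    (h : SwapInvariant U w) {a b : Fin n} (ha : a ∉ U) (hb : b ∉ U) :
    SwapInvariant U (loseWeight a b w) := by
  intro i hi j hj σ
  have ne {x y : Fin n} (hx : x ∉ U) (hy : y ∈ U) : x ≠ y := fun e => hx (e ▸ hy)
  simp only [_root_.loseWeight, Perm.mul_apply, h i hi j hj,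
    swap_apply_of_ne_of_ne (ne ha hi) (ne ha hj), swap_apply_of_ne_of_ne (ne hb hi) (ne hb hj)]

theorem finRange_drop (k : Fin n) :
    (List.finRange n).drop k = k :: (List.finRange n).drop (k + 1) := by
  rw [List.drop_eq_getElem_cons (by simp)]
  simp

theorem le_of_mem_finRange_drop {k : ℕ} {x : Fin n} (hx : x ∈ (List.finRange n).drop k) :
    k ≤ x := by
  obtain ⟨i, hi, rfl⟩ := List.mem_iff_getElem.1 hx
  simp

theorem lossSum_zero (pb : Putback (Fin n)) (w : Perm (Fin n) → ℝ≥0∞) (A : List (Fin n)) (k : ℕ) :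
    lossSum pb w 0 A k = if A = [] then ∑ σ, w σ else 0 := by
  cases A <;> simp [lossSum, lossProb]

theorem lossSum_succ_nil (pb : Putback (Fin n)) (w : Perm (Fin n) → ℝ≥0∞) (R k : ℕ) :
    lossSum pb w (R + 1) [] k = 0 := by
  simp [lossSum, lossProb]

theorem lossSum_wlPutback_succ_cons (w : Perm (Fin n) → ℝ≥0∞) (R : ℕ) (a : Fin n)
    (A : List (Fin n)) (k : Fin n) :
    lossSum wlPutback w (R + 1) (a :: A) k =
      lossSum wlPutback (winWeight a k w) R (A ++ [a, k]) (k + 1) +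
        lossSum wlPutback (loseWeight a k w) R A (k + 1) := by
  simp only [lossSum, finRange_drop, List.map_cons, lossProb_wlPutback_succ_cons,
    ← Finset.sum_add_distrib, List.map_append, List.map_nil, winWeight, loseWeight]
  refine Finset.sum_congr rfl fun σ _ => ?_
  split_ifs <;> simp

theorem lossSum_randomPutback_succ_cons (w : Perm (Fin n) → ℝ≥0∞) (R : ℕ) (a : Fin n)
    (A : List (Fin n)) (k : Fin n) :
    lossSum randomPutback w (R + 1) (a :: A) k =
      2⁻¹ * lossSum randomPutback (winWeight a k w) R (A ++ [a, k]) (k + 1) +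
        2⁻¹ * lossSum randomPutback (winWeight a k w) R (A ++ [k, a]) (k + 1) +
        lossSum randomPutback (loseWeight a k w) R A (k + 1) := by
  simp only [lossSum, finRange_drop, List.map_cons, lossProb_randomPutback_succ_cons,
    ← Finset.sum_add_distrib, List.map_append, List.map_nil, winWeight, loseWeight,
    Finset.mul_sum]
  refine Finset.sum_congr rfl fun σ _ => ?_
  split_ifs
  · ring
  · simp

/-- Reindexing the sum by `σ * swap i j` leaves Bob's remaining positions alone, since they are all
at least `k`. -/
theorem lossSum_swap (pb : Putback (Fin n)) (w : Perm (Fin n) → ℝ≥0∞) (R : ℕ) (A : List (Fin n))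
    {k : ℕ} {i j : Fin n} (hi : i < k) (hj : j < k) :
    lossSum pb w R A k =
      lossSum pb (fun σ => w (σ * swap i j)) R (A.map (swap i j)) k := by
  unfold lossSum
  rw [← Equiv.sum_comp (Equiv.mulRight (swap i j))]
  refine Finset.sum_congr rfl fun σ _ => ?_
  simp only [Equiv.coe_mulRight, List.map_map, Perm.coe_mul]
  congr 2
  refine List.map_congr_left fun x hx => ?_
  have := le_of_mem_finRange_drop hx
  rw [Function.comp_apply, swap_apply_of_ne_of_ne] <;> rintro rfl <;> omega

theorem lossSum_add (pb : Putback (Fin n)) (v w : Perm (Fin n) → ℝ≥0∞) (R : ℕ)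
    (A : List (Fin n)) (k : ℕ) :
    lossSum pb (fun σ => v σ + w σ) R A k = lossSum pb v R A k + lossSum pb w R A k := by
  simp only [lossSum, add_mul, Finset.sum_add_distrib]

theorem map_swap_eq_self {A : List (Fin n)} {i j : Fin n} (hi : i ∉ A) (hj : j ∉ A) :
    A.map (swap i j) = A := by
  conv_rhs => rw [← List.map_id A]
  refine List.map_congr_left fun x hx => swap_apply_of_ne_of_ne ?_ ?_ <;> rintro rfl <;>
    contradiction

/-- The two rounds played by the top cards `a`, `b` may be played in either order. -/
theorem lossSum_wlPutback_swap_top {R : ℕ} {k k' : Fin n} (hk : (k' : ℕ) = k + 1)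
    (ih : ∀ (w : Perm (Fin n) → ℝ≥0∞) (A A' : List (Fin n)), A.Perm A' → (∀ x ∈ A, x ≤ k') →
      SwapInvariant {x | k' < x} w →
      lossSum wlPutback w R A (k' + 1) = lossSum wlPutback w R A' (k' + 1))
    {w : Perm (Fin n) → ℝ≥0∞} (hw : SwapInvariant {x | k ≤ x} w) {a b : Fin n} (ha : a < k)
    (hb : b < k) {C : List (Fin n)} (hC : ∀ x ∈ C, x < k) :
    lossSum wlPutback w (R + 2) (a :: b :: C) k = lossSum wlPutback w (R + 2) (b :: a :: C) k := by
  have hkk' : k < k' := by rw [Fin.lt_def]; omega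
  -- Four outcomes of two rounds. Exchanging `k` and `k'` lets each of `a`, `b` meet the same card
  -- in either playing order, so outcomes match one to one; only after two wins do the resulting
  -- hands differ in order, which `ih` absorbs.
  have expand (a b : Fin n) : lossSum wlPutback w (R + 2) (a :: b :: C) k =
      lossSum wlPutback (winWeight b k' (winWeight a k w)) R (C ++ [a, k] ++ [b, k']) (k' + 1) +
      lossSum wlPutback (loseWeight b k' (winWeight a k w)) R (C ++ [a, k]) (k' + 1) +
      (lossSum wlPutback (winWeight b k' (loseWeight a k w)) R (C ++ [b, k']) (k' + 1) +
      lossSum wlPutback (loseWeight b k' (loseWeight a k w)) R C (k' + 1)) := by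
    rw [lossSum_wlPutback_succ_cons, ← hk, List.cons_append, lossSum_wlPutback_succ_cons,
      lossSum_wlPutback_succ_cons]
  have hw' : SwapInvariant {x | k' < x} w := hw.mono fun x hx => hkk'.le.trans (le_of_lt hx)
  have nm {x : Fin n} (hx : x ≤ k') : x ∉ {x | k' < x} := fun h => absurd hx (not_le.2 h)
  have hak : a ∉ {x | k' < x} := nm (ha.le.trans hkk'.le)
  have hbk : b ∉ {x | k' < x} := nm (hb.le.trans hkk'.le)
  have hkU : k ∉ {x | k' < x} := nm hkk'.le
  have hkU' : k' ∉ {x | k' < x} := nm le_rfl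
  have hCk : ∀ x ∈ C, x ≤ k' := fun x hx => ((hC x hx).trans hkk').le
  have hmap : C.map (swap k k') = C :=
    map_swap_eq_self (fun h => lt_irrefl _ (hC k h)) fun h => lt_asymm hkk' (hC k' h)
  have ea : swap k k' a = a := swap_apply_of_ne_of_ne ha.ne (ha.trans hkk').ne
  have eb : swap k k' b = b := swap_apply_of_ne_of_ne hb.ne (hb.trans hkk').ne
  have ew (σ) : w (σ * swap k k') = w σ := hw k (by simp) k' (by simpa using hkk'.le) σ
  have hkl : (k : ℕ) < k' + 1 := by omega
  rw [expand a b, expand b a]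
  have h1 : lossSum wlPutback (winWeight a k' (winWeight b k w)) R (C ++ [b, k] ++ [a, k'])
      (k' + 1) = lossSum wlPutback (winWeight b k' (winWeight a k w)) R (C ++ [a, k] ++ [b, k'])
      (k' + 1) := by
    rw [lossSum_swap _ _ _ _ hkl (Nat.lt_succ_self _)]
    simp only [List.map_append, List.map_cons, List.map_nil, hmap, ea, eb, swap_apply_left,
      swap_apply_right]
    have : (fun σ => winWeight a k' (winWeight b k w) (σ * swap k k')) =
        winWeight b k' (winWeight a k w) := by
      ext σ
      simp only [winWeight, Perm.mul_apply, ea, eb, ew, swap_apply_left, swap_apply_right]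
      split_ifs <;> rfl
    rw [this]
    refine ih _ _ _ ?_ ?_ ((hw'.winWeight hak hkU).winWeight hbk hkU')
    · simp only [List.append_assoc]
      exact List.perm_append_comm.append_left C
    · simp only [List.mem_append, List.mem_cons, List.not_mem_nil, or_false]
      rintro x ((hx | rfl | rfl) | rfl | rfl)
      exacts [hCk x hx, (hb.trans hkk').le, le_rfl, (ha.trans hkk').le, hkk'.le]
  have h2 : lossSum wlPutback (winWeight a k' (loseWeight b k w)) R (C ++ [a, k']) (k' + 1) =
      lossSum wlPutback (loseWeight b k' (winWeight a k w)) R (C ++ [a, k]) (k' + 1) := by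
    rw [lossSum_swap _ _ _ _ hkl (Nat.lt_succ_self _)]
    simp only [List.map_append, List.map_cons, List.map_nil, hmap, ea, swap_apply_right]
    congr 1
    ext σ
    simp only [winWeight, loseWeight, Perm.mul_apply, ea, eb, ew, swap_apply_left,
      swap_apply_right]
    split_ifs <;> rfl
  have h3 : lossSum wlPutback (loseWeight a k' (winWeight b k w)) R (C ++ [b, k]) (k' + 1) =
      lossSum wlPutback (winWeight b k' (loseWeight a k w)) R (C ++ [b, k']) (k' + 1) := by
    rw [lossSum_swap _ _ _ _ hkl (Nat.lt_succ_self _)]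
    simp only [List.map_append, List.map_cons, List.map_nil, hmap, eb, swap_apply_left]
    congr 1
    ext σ
    simp only [winWeight, loseWeight, Perm.mul_apply, ea, eb, ew, swap_apply_left,
      swap_apply_right]
    split_ifs <;> rfl
  have h4 : lossSum wlPutback (loseWeight a k' (loseWeight b k w)) R C (k' + 1) =
      lossSum wlPutback (loseWeight b k' (loseWeight a k w)) R C (k' + 1) := by
    rw [lossSum_swap _ _ _ _ hkl (Nat.lt_succ_self _), hmap]
    congr 1
    ext σ
    simp only [loseWeight, Perm.mul_apply, ea, eb, ew, swap_apply_left, swap_apply_right]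
    split_ifs <;> rfl
  rw [h1, h2, h3, h4]
  ring

/-- The order of Alice's hand does not influence the law of the number of rounds. -/
theorem lossSum_wlPutback_perm (R k : ℕ) (hkR : k + R ≤ n) {w : Perm (Fin n) → ℝ≥0∞}
    (hw : SwapInvariant {x | k ≤ (x : ℕ)} w) {A A' : List (Fin n)} (hA : ∀ x ∈ A, (x : ℕ) < k)
    (h : A.Perm A') : lossSum wlPutback w R A k = lossSum wlPutback w R A' k := by
  -- Strong induction, because exchanging the top two cards uses up two rounds.
  induction R using Nat.strong_induction_on generalizing k w A A' with
  | _ R ih =>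
  obtain _ | R := R
  · simp only [lossSum_zero, ← List.length_eq_zero_iff, h.length_eq]
  have hkn : k < n := by omega
  induction h with
  | nil => rfl
  | trans h₁ _ ih₁ ih₂ => exact (ih₁ hA).trans (ih₂ fun x hx => hA x (h₁.mem_iff.2 hx))
  | cons a h _ =>
    have hw' : SwapInvariant {x | k + 1 ≤ (x : ℕ)} w :=
      hw.mono fun x (hx : k + 1 ≤ (x : ℕ)) => (Nat.le_of_succ_le hx : k ≤ (x : ℕ))
    have ha : (a : ℕ) < k := hA a List.mem_cons_self
    have ha' : a ∉ {x : Fin n | k + 1 ≤ (x : ℕ)} := by simp; omega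
    have hk' : (⟨k, hkn⟩ : Fin n) ∉ {x : Fin n | k + 1 ≤ (x : ℕ)} := by simp
    have e := lossSum_wlPutback_succ_cons w R a
    have e₁ := fun A => e A ⟨k, hkn⟩
    simp only at e₁
    rw [e₁, e₁]
    congr 1
    · refine ih R (Nat.lt_succ_self R) (k + 1) (by omega) (hw'.winWeight ha' hk') ?_
        (h.append_right _)
      simp only [List.mem_append, List.mem_cons, List.not_mem_nil, or_false]
      rintro x (hx | rfl | rfl)
      exacts [(hA x (List.mem_cons_of_mem _ hx)).trans (Nat.lt_succ_self k),
        ha.trans (Nat.lt_succ_self k), Nat.lt_succ_self k]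
    · exact ih R (Nat.lt_succ_self R) (k + 1) (by omega) (hw'.loseWeight ha' hk')
        (fun x hx => (hA x (List.mem_cons_of_mem _ hx)).trans (Nat.lt_succ_self k)) h
  | swap a b C =>
    have ha : (a : ℕ) < k := hA a (by simp)
    have hb : (b : ℕ) < k := hA b (by simp)
    -- One round cannot empty a hand of at least two cards: both sides are `0`.
    obtain _ | R := R
    · have e (a b : Fin n) := lossSum_wlPutback_succ_cons w 0 a (b :: C) ⟨k, hkn⟩
      simp only [lossSum_zero] at e
      rw [e, e]
      simp
    · refine lossSum_wlPutback_swap_top (k := ⟨k, hkn⟩) (k' := ⟨k + 1, by omega⟩) rfl ?_ hw hb ha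
        fun x hx => hA x (by simp [hx])
      intro w A A' h hA hw
      exact ih R (by omega) (k + 2) (by omega) hw
        (fun x hx => Nat.lt_succ_of_le (Fin.le_def.1 (hA x hx))) h

/-- By order independence both results of the coin have the same continuation, so the two halves
recombine into the WL term. -/
theorem lossSum_randomPutback (R k : ℕ) (hkR : k + R ≤ n) {w : Perm (Fin n) → ℝ≥0∞}
    (hw : SwapInvariant {x | k ≤ (x : ℕ)} w) {A : List (Fin n)} (hA : ∀ x ∈ A, (x : ℕ) < k) :
    lossSum randomPutback w R A k = lossSum wlPutback w R A k := by
  induction R generalizing k w A with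
  | zero => simp only [lossSum_zero]
  | succ R ih =>
    obtain _ | ⟨a, A⟩ := A
    · simp only [lossSum_succ_nil]
    have hkn : k < n := by omega
    have hw' : SwapInvariant {x | k + 1 ≤ (x : ℕ)} w :=
      hw.mono fun x (hx : k + 1 ≤ (x : ℕ)) => (Nat.le_of_succ_le hx : k ≤ (x : ℕ))
    have ha : (a : ℕ) < k := hA a List.mem_cons_self
    have ha' : a ∉ {x : Fin n | k + 1 ≤ (x : ℕ)} := by simp; omega
    have hk' : (⟨k, hkn⟩ : Fin n) ∉ {x : Fin n | k + 1 ≤ (x : ℕ)} := by simp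
    have hwin := hw'.winWeight ha' hk'
    have hA₁ : ∀ x ∈ A ++ [a, ⟨k, hkn⟩], (x : ℕ) < k + 1 := by
      simp only [List.mem_append, List.mem_cons, List.not_mem_nil, or_false]
      rintro x (hx | rfl | rfl)
      exacts [(hA x (List.mem_cons_of_mem _ hx)).trans (Nat.lt_succ_self k),
        ha.trans (Nat.lt_succ_self k), Nat.lt_succ_self k]
    have hp : (A ++ [⟨k, hkn⟩, a]).Perm (A ++ [a, ⟨k, hkn⟩]) := (List.Perm.swap _ _ _).append_left A
    have hA₂ : ∀ x ∈ A ++ [⟨k, hkn⟩, a], (x : ℕ) < k + 1 := fun x hx => hA₁ x (hp.mem_iff.1 hx)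
    have e₁ := lossSum_randomPutback_succ_cons w R a A ⟨k, hkn⟩
    have e₂ := lossSum_wlPutback_succ_cons w R a A ⟨k, hkn⟩
    simp only at e₁ e₂
    rw [e₁, e₂, ih (k + 1) (by omega) hwin hA₁, ih (k + 1) (by omega) hwin hA₂,
      ih (k + 1) (by omega) (hw'.loseWeight ha' hk')
        fun x hx => (hA x (List.mem_cons_of_mem _ hx)).trans (Nat.lt_succ_self k),
      lossSum_wlPutback_perm R (k + 1) (by omega) hwin hA₂ hp, ← add_mul,
      ENNReal.inv_two_add_inv_two, one_mul]

end Average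

/-! ### Alice's hand size as a simple random walk. -/

/-- The number of walks with steps `±1` from `m` that reach `0` for the first time after `R`
steps. -/
def firstPassageCount : ℕ → ℕ → ℕ
  | 0, 0 => 1
  | 0, _ + 1 => 0
  | _ + 1, 0 => 0
  | m + 1, R + 1 => firstPassageCount m R + firstPassageCount (m + 2) R

section Average

open Equiv

variable {n : ℕ}

/-- Symmetry is now also required within Alice's hand, so that her top card `a` and the fresh card
`K` are exchangeable. -/
theorem two_pow_mul_lossSum_wlPutback (R k : ℕ) (hkR : k + R ≤ n) {A : List (Fin n)}
    (hA : ∀ x ∈ A, (x : ℕ) < k) (hnd : A.Nodup) {w : Perm (Fin n) → ℝ≥0∞}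
    (hw : SwapInvariant {x | x ∈ A ∨ k ≤ (x : ℕ)} w) :
    2 ^ R * lossSum wlPutback w R A k = firstPassageCount A.length R * ∑ σ, w σ := by
  induction R generalizing k w A with
  | zero =>
    cases A <;> simp [lossSum_zero, firstPassageCount]
  | succ R ih =>
    obtain _ | ⟨a, A⟩ := A
    · simp [lossSum_succ_nil, firstPassageCount]
    have hkn : k < n := by omega
    obtain ⟨K, rfl⟩ : ∃ K : Fin n, k = K := ⟨⟨k, hkn⟩, rfl⟩
    have ha : a < K := hA a List.mem_cons_self
    have hAK : ∀ x ∈ A, x < K := fun x hx => hA x (List.mem_cons_of_mem _ hx)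
    have hKA : K ∉ A := fun h => lt_irrefl _ (hAK K h)
    obtain ⟨haA, hndA⟩ := List.nodup_cons.1 hnd
    have hww : ∀ σ, w (σ * swap a K) = w σ := hw a (by simp) K (by simp)
    have hwin : SwapInvariant {x : Fin n | (K : ℕ) + 1 ≤ x} (loseWeight a K w) := by
      refine SwapInvariant.loseWeight (U := {x : Fin n | (K : ℕ) + 1 ≤ x})
        (hw.mono fun x (hx : (K : ℕ) + 1 ≤ x) => Or.inr (Nat.le_of_succ_le hx)) ?_ ?_
      · have := Fin.lt_def.1 ha
        simp only [Set.mem_ofPred_eq]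
        omega
      · simp
    have hswap : (fun σ => winWeight a K w (σ * swap a K)) = loseWeight a K w := by
      ext σ
      have : σ a ≠ σ K := fun h => ha.ne (σ.injective h)
      simp only [winWeight, loseWeight, Perm.mul_apply, swap_apply_left, swap_apply_right, hww]
      rcases this.lt_or_gt with h | h
      · simp [h, h.not_gt]
      · simp [h, h.not_gt]
    have hadd : (fun σ => winWeight a K w σ + loseWeight a K w σ) = w := by
      ext σ
      simp only [winWeight, loseWeight]
      split_ifs <;> simp
    have hA₁ : ∀ x ∈ A ++ [a, K], (x : ℕ) < K + 1 := by
      simp only [List.mem_append, List.mem_cons, List.not_mem_nil, or_false]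
      rintro x (hx | rfl | rfl)
      exacts [Nat.lt_succ_of_lt (Fin.lt_def.1 (hAK x hx)), Nat.lt_succ_of_lt ha, Nat.lt_succ_self _]
    have hp : (A ++ [K, a]).Perm (A ++ [a, K]) := (List.Perm.swap _ _ _).append_left A
    have hA₂ : ∀ x ∈ A ++ [K, a], (x : ℕ) < K + 1 := fun x hx => hA₁ x (hp.mem_iff.1 hx)
    have hsum : 2 * ∑ σ, loseWeight a K w σ = ∑ σ, w σ := by
      rw [two_mul]
      conv_lhs => enter [1]; rw [← hswap]
      change ∑ σ, winWeight a K w (Equiv.mulRight (swap a K) σ) + _ = _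
      rw [Equiv.sum_comp (Equiv.mulRight (swap a K)) (winWeight a K w), ← Finset.sum_add_distrib]
      exact congrArg (fun f => ∑ σ, f σ) hadd
    have hwinloss : lossSum wlPutback (winWeight a K w) R (A ++ [a, K]) (K + 1) =
        lossSum wlPutback (loseWeight a K w) R (A ++ [a, K]) (K + 1) := by
      rw [lossSum_swap _ _ _ _ (Nat.lt_succ_of_lt ha) (Nat.lt_succ_self _), hswap,
        List.map_append, map_swap_eq_self haA hKA]
      simp only [List.map_cons, List.map_nil, swap_apply_left, swap_apply_right]
      exact lossSum_wlPutback_perm R _ (by omega) hwin hA₂ hp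
    -- The win and lose weights on the same hand add up to `w`: the comparison is forgotten and full
    -- symmetry restored.
    have hdouble : 2 * lossSum wlPutback (winWeight a K w) R (A ++ [a, K]) (K + 1) =
        lossSum wlPutback w R (A ++ [a, K]) (K + 1) := by
      rw [two_mul]
      conv_lhs => enter [2]; rw [hwinloss]
      rw [← lossSum_add, hadd]
    have ih₁ := ih (K + 1) (by omega) hA₁
      (by
        rw [List.nodup_append]
        refine ⟨hndA, by simpa using ha.ne, ?_⟩
        simp only [List.mem_cons, List.not_mem_nil, or_false]
        rintro x hx y (rfl | rfl) rfl
        exacts [haA hx, hKA hx])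
      (w := w) (hw.mono (by
        rintro x (hx | hx)
        · simp only [List.mem_append, List.mem_cons, List.not_mem_nil, or_false] at hx
          rcases hx with hx | rfl | rfl
          exacts [Or.inl (List.mem_cons_of_mem _ hx), Or.inl List.mem_cons_self, Or.inr le_rfl]
        · exact Or.inr (Nat.le_of_succ_le hx)))
    -- After a loss the symmetry between `a` and `K` is broken, but neither position is in play any
    -- more.
    have ih₂ := ih (K + 1) (by omega) (fun x hx => Nat.lt_succ_of_lt (Fin.lt_def.1 (hAK x hx))) hndA
      (w := loseWeight a K w) (by
        refine (hw.mono ?_).loseWeight ?_ ?_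
        · rintro x (hx | hx)
          exacts [Or.inl (List.mem_cons_of_mem _ hx), Or.inr (Nat.le_of_succ_le hx)]
        · rintro (h | h)
          · exact haA h
          · have := Fin.lt_def.1 ha
            omega
        · rintro (h | h)
          · exact hKA h
          · omega)
    rw [lossSum_wlPutback_succ_cons, List.length_cons, firstPassageCount, Nat.cast_add, add_mul]
    calc 2 ^ (R + 1) * (lossSum wlPutback (winWeight a K w) R (A ++ [a, K]) (K + 1) +
          lossSum wlPutback (loseWeight a K w) R A (K + 1))
        = 2 ^ R * (2 * lossSum wlPutback (winWeight a K w) R (A ++ [a, K]) (K + 1)) +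
          2 * (2 ^ R * lossSum wlPutback (loseWeight a K w) R A (K + 1)) := by ring
      _ = _ := by
        rw [hdouble, ih₁, ih₂, mul_left_comm, hsum, add_comm]
        simp

theorem rRoundProb_eq {m R : ℕ} (hn : m + R ≤ n) (pb : Putback (Fin n))
    (hpb : ∀ A : List (Fin n), (∀ x ∈ A, (x : ℕ) < m) →
      lossSum pb (fun _ => 1) R A m = lossSum wlPutback (fun _ => 1) R A m) :
    rRoundProb n m R pb = firstPassageCount m R / 2 ^ R := by
  -- The passthrough bound is automatic, as `R ≤ n - m`.
  have hset : singleUseRRound n m R = {c | c.alice = [] ∧ c.rounds = 0 + R} := by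
    ext c
    simp only [singleUseRRound, Set.mem_ofPred_eq]
    constructor
    · rintro ⟨h, -, h'⟩; exact ⟨h, by omega⟩
    · rintro ⟨h, h'⟩; exact ⟨h, by omega, by omega⟩
  have hσ (σ : Perm (Fin n)) :
      (playRounds pb R (initialConfig m σ)).toOuterMeasure (singleUseRRound n m R) =
        lossProb pb R (((List.finRange n).take m).map σ) (((List.finRange n).drop m).map σ) := by
    have := toOuterMeasure_playRounds pb R (((List.finRange n).take m).map σ)
      (((List.finRange n).drop m).map σ) [] 0 (by simp; omega)
    rw [hset, ← this, initialConfig, List.append_nil, List.ofFn_eq_map, List.map_take,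
      List.map_drop]
  have hA : ∀ x ∈ (List.finRange n).take m, (x : ℕ) < m := by
    intro x hx
    obtain ⟨i, hi, rfl⟩ := List.mem_iff_getElem.1 hx
    simp at hi ⊢
    omega
  have key := two_pow_mul_lossSum_wlPutback R m hn hA
    ((List.nodup_finRange n).sublist (List.take_sublist _ _)) (w := fun _ => 1)
    (fun _ _ _ _ _ => rfl)
  have hlen : ((List.finRange n).take m).length = m := by simp; omega
  have hcard : ((Fintype.card (Perm (Fin n)) : ℕ) : ℝ≥0∞) ≠ 0 := by
    exact_mod_cast Fintype.card_ne_zero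
  rw [hlen, ← hpb _ hA] at key
  simp only [lossSum, one_mul, Finset.sum_const, Finset.card_univ, nsmul_eq_mul, mul_one] at key
  rw [rRoundProb, warLaw, PMF.toOuterMeasure_bind_apply, tsum_fintype]
  simp only [PMF.uniformOfFintype_apply, hσ, ← Finset.mul_sum]
  rw [ENNReal.eq_div_iff (by simp) (by simp), mul_left_comm, key, mul_left_comm,
    ENNReal.inv_mul_cancel hcard (ENNReal.natCast_ne_top _), mul_one]

end Average

/-! ### First passages and the Catalan triangle. -/

section Catalan

open DyckStep

/-- The strings counted by `catalanTriangle p q`. -/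
def ballotStrings (p q : ℕ) : Set (List DyckStep) :=
  {s | s.count U = p ∧ s.count D = q ∧ ∀ i : ℕ, (s.take i).count D ≤ (s.take i).count U}

theorem catalanTriangle_eq_ncard (p q : ℕ) : catalanTriangle p q = (ballotStrings p q).ncard := rfl

theorem length_eq_of_mem_ballotStrings {p q : ℕ} {s : List DyckStep} (hs : s ∈ ballotStrings p q) :
    s.length = p + q := by
  obtain ⟨rfl, rfl, -⟩ := hs
  induction s with
  | nil => rfl
  | cons x s ih => cases x <;> simp [ih] <;> omega

theorem ballotStrings_finite (p q : ℕ) : (ballotStrings p q).Finite :=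
  have : Finite DyckStep := Finite.of_injective (fun x => decide (x = U)) fun x y => by
    cases x <;> cases y <;> simp
  (List.finite_length_eq DyckStep (p + q)).subset fun _ => length_eq_of_mem_ballotStrings

theorem forall_take_concat {s : List DyckStep} {x : DyckStep} :
    (∀ i : ℕ, ((s ++ [x]).take i).count D ≤ ((s ++ [x]).take i).count U) ↔
      (∀ i : ℕ, (s.take i).count D ≤ (s.take i).count U) ∧
        (s ++ [x]).count D ≤ (s ++ [x]).count U := by
  constructor
  · intro h
    refine ⟨fun i => ?_, by simpa [List.take_of_length_le] using h (s.length + 1)⟩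
    rcases le_total i s.length with hi | hi
    · simpa [List.take_append_of_le_length hi] using h i
    · simpa [List.take_of_length_le hi] using h s.length
  · rintro ⟨h, h'⟩ i
    rcases Nat.lt_or_ge s.length i with hi | hi
    · rwa [List.take_of_length_le (by simp; omega)]
    · rw [List.take_append_of_le_length hi]
      exact h i

theorem catalanTriangle_eq_zero {p q : ℕ} (h : p < q) : catalanTriangle p q = 0 := by
  rw [catalanTriangle_eq_ncard, Set.ncard_eq_zero (ballotStrings_finite p q)]
  ext s
  simp only [Set.mem_empty_iff_false, iff_false]
  rintro ⟨rfl, rfl, hs⟩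
  have := hs s.length
  rw [List.take_length] at this
  omega

theorem catalanTriangle_zero_right (p : ℕ) : catalanTriangle p 0 = 1 := by
  rw [catalanTriangle_eq_ncard, Set.ncard_eq_one]
  refine ⟨List.replicate p U, ?_⟩
  ext s
  simp only [Set.mem_singleton_iff]
  constructor
  · intro hs
    have hl := length_eq_of_mem_ballotStrings hs
    obtain ⟨-, h, -⟩ := hs
    refine List.eq_replicate_iff.2 ⟨hl, fun x hx => ?_⟩
    cases x
    · rfl
    · exact absurd hx (List.count_eq_zero.1 h)
  · rintro rfl
    refine ⟨by simp, by simp [List.count_replicate], fun i => ?_⟩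
    simp [List.take_replicate, List.count_replicate]

/-- Split by the last letter; `q ≤ p` makes the full string satisfy the prefix condition. -/
theorem catalanTriangle_succ_succ {p q : ℕ} (h : q ≤ p) :
    catalanTriangle (p + 1) (q + 1) = catalanTriangle p (q + 1) + catalanTriangle (p + 1) q := by
  have hset : ballotStrings (p + 1) (q + 1) =
      (fun s => s ++ [U]) '' ballotStrings p (q + 1) ∪
        (fun s => s ++ [D]) '' ballotStrings (p + 1) q := by
    ext s
    simp only [Set.mem_union, Set.mem_image]
    constructor
    · intro hs
      have hne : s ≠ [] := by
        rintro rfl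
        simpa using hs.1
      obtain ⟨t, x, rfl⟩ : ∃ t x, s = t ++ [x] := ⟨_, _, (List.dropLast_append_getLast hne).symm⟩
      obtain ⟨h₁, h₂, h₃⟩ := hs
      replace h₃ := (forall_take_concat.1 h₃).1
      cases x
      · exact Or.inl ⟨t, ⟨by simpa using h₁, by simpa using h₂, h₃⟩, rfl⟩
      · exact Or.inr ⟨t, ⟨by simpa using h₁, by simpa using h₂, h₃⟩, rfl⟩
    · rintro (⟨t, ⟨h₁, h₂, h₃⟩, rfl⟩ | ⟨t, ⟨h₁, h₂, h₃⟩, rfl⟩)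
      · refine ⟨by simp [h₁], by simp [h₂], forall_take_concat.2 ⟨h₃, ?_⟩⟩
        simp [h₁, h₂]; omega
      · refine ⟨by simp [h₁], by simp [h₂], forall_take_concat.2 ⟨h₃, ?_⟩⟩
        simp [h₁, h₂]; omega
  simp only [catalanTriangle_eq_ncard, hset]
  rw [Set.ncard_union_eq _ ((ballotStrings_finite _ _).image _)
    ((ballotStrings_finite _ _).image _),
    Set.ncard_image_of_injective _ (List.append_left_injective _),
    Set.ncard_image_of_injective _ (List.append_left_injective _)]
  rw [Set.disjoint_left]
  rintro _ ⟨s, -, rfl⟩ ⟨t, -, h⟩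
  have := List.append_inj_right' h rfl
  simp at this

/-- The first-step recursion of the walk is the last-letter recursion of the triangle, with `q` the
number of up-steps. -/
theorem firstPassageCount_succ_add_two_mul (m q : ℕ) :
    firstPassageCount (m + 1) (m + 1 + 2 * q) = catalanTriangle (m + q) q := by
  induction hN : m + 2 * q using Nat.strong_induction_on generalizing m q with
  | _ N ih =>
  rw [show m + 1 + 2 * q = m + 2 * q + 1 by ring, firstPassageCount]
  -- Each step lowers the walk by at most one.
  have h₀ : ∀ m R, R < m → firstPassageCount m R = 0 := by
    intro m R
    induction R generalizing m with
    | zero => intro h; obtain ⟨m, rfl⟩ := Nat.exists_eq_succ_of_ne_zero h.ne'; rfl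
    | succ R ih' =>
      intro h
      obtain ⟨m, rfl⟩ := Nat.exists_eq_succ_of_ne_zero (Nat.ne_of_gt (Nat.zero_lt_of_lt h))
      rw [firstPassageCount, ih' m (by omega), ih' (m + 2) (by omega)]
  obtain _ | q := q
  · rw [h₀ (m + 2) _ (by omega), catalanTriangle_zero_right]
    obtain _ | m := m
    · rfl
    · have := ih (m + 2 * 0) (by omega) m 0 rfl
      rw [catalanTriangle_zero_right] at this
      rw [this]
  · have e₁ : firstPassageCount (m + 2) (m + 2 * (q + 1)) = catalanTriangle (m + q + 1) q := by
      have := ih (m + 1 + 2 * q) (by omega) (m + 1) q rfl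
      rw [show m + 2 * (q + 1) = m + 1 + 1 + 2 * q by ring, this]
      congr 1; omega
    have e₂ : firstPassageCount m (m + 2 * (q + 1)) = catalanTriangle (m + q) (q + 1) := by
      -- A walk at `0` has already arrived, so no later first passage counts; this matches the
      -- vanishing of the triangle for `p < q`.
      obtain _ | m := m
      · rw [catalanTriangle_eq_zero (by omega), show 0 + 2 * (q + 1) = 2 * q + 1 + 1 by ring]
        rfl
      · have := ih (m + 2 * (q + 1)) (by omega) m (q + 1) rfl
        rw [this]
        congr 1; omega
    rw [e₁, e₂, ← add_assoc, catalanTriangle_succ_succ (by omega)]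

theorem firstPassageCount_eq_zero {m R : ℕ} (h : ¬ (m ≤ R ∧ R ≡ m [MOD 2])) :
    firstPassageCount m R = 0 := by
  induction R generalizing m with
  | zero =>
    obtain _ | m := m
    · exact absurd ⟨le_rfl, rfl⟩ h
    · rfl
  | succ R ih =>
    obtain _ | m := m
    · rfl
    · simp only [Nat.ModEq] at h ih
      rw [firstPassageCount, ih (by omega), ih (by omega)]

end Catalan

theorem mainTheorem1 (n m R : ℕ) (hm : 1 ≤ m) (hn : m + R ≤ n) :
    (m ≤ R → R ≡ m [MOD 2] →
      rRoundProb n m R wlPutback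
          = (catalanTriangle ((R + m) / 2 - 1) ((R - m) / 2) : ℝ≥0∞) / 2 ^ R ∧
        rRoundProb n m R randomPutback
          = (catalanTriangle ((R + m) / 2 - 1) ((R - m) / 2) : ℝ≥0∞) / 2 ^ R) ∧
    (¬ (m ≤ R ∧ R ≡ m [MOD 2]) →
      rRoundProb n m R wlPutback = 0 ∧ rRoundProb n m R randomPutback = 0) := by
  rw [rRoundProb_eq hn wlPutback fun _ _ => rfl, rRoundProb_eq hn randomPutback fun _ hA =>
    lossSum_randomPutback R m hn (fun _ _ _ _ _ => rfl) hA]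
  refine ⟨fun h₁ h₂ => ?_, fun h => ?_⟩
  · have : firstPassageCount m R = catalanTriangle ((R + m) / 2 - 1) ((R - m) / 2) := by
      rw [Nat.ModEq] at h₂
      obtain ⟨m, rfl⟩ : ∃ m', m = m' + 1 := ⟨m - 1, by omega⟩
      -- Here `q` is the number of rounds that Alice wins.
      obtain ⟨q, rfl⟩ : ∃ q, R = m + 1 + 2 * q := ⟨(R - (m + 1)) / 2, by omega⟩
      rw [firstPassageCount_succ_add_two_mul]
      congr 1 <;> omega
    rw [this]
    exact ⟨rfl, rfl⟩
  · simp [firstPassageCount_eq_zero h]
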